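/- Let $\beta, L > 0$. With $l = \lfloor\beta\rfloor$, let $\Sigma(\beta,L)$ be the set of $l$-times differentiable functions $f:\mathbb{R}\to\mathbb{R}$ with $$|f^{(l)}(x)-f^{(l)}(x')| \le L\,|x-x'|^{\beta-l}\qquad\text{for all } x,x'\in\mathbb{R},$$ and let $\mathcal{P}(\beta,L)$ be the set of probability densities (with respect to Lebesgue measure on $\mathbb{R}$) that belong to $\Sigma(\beta,L)$. For $\alpha>0$, a channel, i.e. a Markov kernel $Q(\cdot\mid x)$ from $\mathbb{R}$ to a measurable space $(\mathcal{Z},\mathscr{Z})$, is called $\alpha$-differentially locally private if $$Q(B\mid x)\le e^{\alpha}\,Q(B\mid x')\qquad\text{for all } B\in\mathscr{Z}\text{ and } x,x'\in\mathbb{R}.$$ For $n\in\mathbb{N}$ let $\mathcal{Q}_\alpha$ be the family of all (non-interactive) $\alpha$-differentially locally private mechanisms for $n$ observations: such a mechanism $Q$ consists of $\alpha$-differentially locally private channels $Q_1,\dots,Q_n$ with arbitrary output spaces $\mathcal{Z}_1,\dots,\mathcal{Z}_n$ (in particular, one and the same channel may be used for all observations). If $X_1,\dots,X_n$ are i.i.d.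 with density $f$ and, conditionally on them, $Z_1,\dots,Z_n$ are independent with $Z_i\sim Q_i(\cdot\mid X_i)$, write $\mathbb{E}_{f,Q}$ for the expectation under the law of $(Z_1,\dots,Z_n)$. An estimator $T_n$ is a measurable real-valued function of $(Z_1,\dots,Z_n)$. Theorem (Lower bound). There is a constant $C>0$ depending only on $\beta$ and $L$ such that, for every $\alpha>0$ and every $t\in\mathbb{R}$, $$\liminf_{n\to\infty}\ \inf_{T_n}\ \inf_{Q\in\mathcal{Q}_\alpha}\ \sup_{f\in\mathcal{P}(\beta,L)}\ \mathbb{E}_{f,Q}\Big[\big(n(e^{\alpha}-1)^2\big)^{\frac{2\beta}{2\beta+2}}\,|T_n-f(t)|^2\Big]\ \ge\ C .$$ -/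

import Mathlib

open MeasureTheory ProbabilityTheory Filter
open scoped ENNReal

universe u

noncomputable section

namespace PrivateDensity

/-- The Hölder class `Σ(β, L)` on `ℝ`: with `l = ⌊β⌋`, the functions that are `l` times
differentiable on `ℝ` and whose `l`-th derivative satisfies
`|f⁽ˡ⁾(x) - f⁽ˡ⁾(x')| ≤ L |x - x'| ^ (β - l)` for all `x, x'`. -/
def HolderClass (β L : ℝ) : Set (ℝ → ℝ) :=
  {f | (∀ k < ⌊β⌋₊, Differentiable ℝ (iteratedDeriv k f)) ∧
    ∀ x x' : ℝ, |iteratedDeriv ⌊β⌋₊ f x - iteratedDeriv ⌊β⌋₊ f x'| ≤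
      L * |x - x'| ^ (β - (⌊β⌋₊ : ℝ))}

/-- `f` is a probability density with respect to Lebesgue measure on `ℝ`. -/
def IsDensity (f : ℝ → ℝ) : Prop :=
  (∀ x, 0 ≤ f x) ∧ Integrable f ∧ ∫ x, f x = 1

/-- The class `𝒫(β, L)` of Hölder smooth densities. -/
def HolderDensities (β L : ℝ) : Set (ℝ → ℝ) :=
  {f | IsDensity f ∧ f ∈ HolderClass β L}

/-- The distribution on `ℝ` of a raw observation with Lebesgue density `f`. -/
def rawLaw (f : ℝ → ℝ) : Measure ℝ :=
  volume.withDensity fun x => ENNReal.ofReal (f x)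

/-- The channel `Q(· | x)` satisfies the `α`-differential privacy constraint
`Q(B | x) ≤ exp α * Q(B | x')` for all measurable `B` and all `x, x'`. -/
def IsLocallyPrivate (α : ℝ) {Z : Type u} [MeasurableSpace Z] (Q : Kernel ℝ Z) : Prop :=
  ∀ B : Set Z, MeasurableSet B → ∀ x x' : ℝ,
    Q x B ≤ ENNReal.ofReal (Real.exp α) * Q x' B

/-- A (non-interactive) `α`-differentially locally private mechanism for `n` observations:
the `i`-th data holder releases `Zᵢ`, with values in an arbitrary measurable space, drawn from
a channel `Q i (· | Xᵢ)` that satisfies the privacy constraint. One channel that is used by all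
data holders is the special case in which `Out` and `channel` do not depend on `i`. -/
structure PrivacyMechanism (α : ℝ) (n : ℕ) : Type (u + 1) where
  /-- The space of sanitized observations of the `i`-th data holder. -/
  Out : Fin n → Type u
  /-- Its σ-algebra. -/
  instOut : ∀ i, MeasurableSpace (Out i)
  /-- The channel of the `i`-th data holder. -/
  channel : ∀ i, Kernel ℝ (Out i)
  isMarkov : ∀ i, IsMarkovKernel (channel i)
  isPrivate : ∀ i, IsLocallyPrivate α (channel i)

attribute [instance] PrivacyMechanism.instOut PrivacyMechanism.isMarkov

/-- The law `ℙ_{f,Q}` of the private view `(Z₁, …, Zₙ)`, when `X₁, …, Xₙ` are i.i.d. with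
density `f` and `Zᵢ` is drawn from `Q i (· | Xᵢ)` independently for each `i`: the product of
the marginal laws `∫ Q i (· | x) f(x) dx`. -/
def PrivacyMechanism.viewLaw {α : ℝ} {n : ℕ} (Q : PrivacyMechanism.{u} α n) (f : ℝ → ℝ) :
    Measure (∀ i, Q.Out i) :=
  Measure.pi fun i => (rawLaw f).bind (Q.channel i)

/-- The normalized private minimax risk at the point `t`,
`inf_T inf_Q sup_{f ∈ 𝒫(β,L)} 𝔼_{f,Q} [(n (exp α - 1)²) ^ (2β/(2β+2)) |T - f(t)|²]`,
as an extended nonnegative number. The space on which an estimator `T` (a measurable real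
function of the private view) is defined depends on `Q`, so the two infima are taken jointly. -/
def normalizedMinimaxRisk (β L α t : ℝ) (n : ℕ) : ℝ≥0∞ :=
  ⨅ (Q : PrivacyMechanism.{u} α n) (T : (∀ i, Q.Out i) → ℝ) (_ : Measurable T),
    ⨆ f ∈ HolderDensities β L,
      ∫⁻ z, ENNReal.ofReal
        (((n : ℝ) * (Real.exp α - 1) ^ 2) ^ (2 * β / (2 * β + 2)) * |T z - f t| ^ 2)
        ∂(Q.viewLaw f)

end PrivateDensity

end

open scoped ContDiff Topology

namespace PrivateDensity

/-! ### Smooth functions in the Hölder class -/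

/-! Le Cam's two-point method, with privacy acting as a contraction. Under a private channel the map
`x ↦ Q(B | x)` varies by at most a factor `exp α`, so replacing `f₀` by `f₁` changes the mass of `B`
by a relative error of at most `δ = (exp α - 1) ‖f₁ - f₀‖₁` (`abs_sub_bind_le`). Hence one private
observation has chi-square divergence at most `δ²`, and `n` of them have second moment at most `(1 +
δ²)^n ≤ exp (n δ²)`.

A Hölder bump of width `h` has height of order `h ^ β` and `L¹` norm of order `h ^ (β + 1)`
(`exists_density_pairs`). Taking `n (exp α - 1)² h ^ (2β + 2) = 1` keeps `n δ²` bounded, while the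
squared separation is of order `h ^ (2β)`, the inverse of the normalization. Since the `L¹` norm
governs the divergence, the exponent has `2β + 2` in place of the classical `2β + 1`. -/

theorem hasCompactSupport_iteratedDeriv {f : ℝ → ℝ} (hf : HasCompactSupport f) (n : ℕ) :
    HasCompactSupport (iteratedDeriv n f) := by
  induction n with
  | zero => simpa using hf
  | succ n ih =>
    rw [iteratedDeriv_succ]
    exact ih.deriv

/-- A bounded Lipschitz function is Hölder continuous of every order in `[0, 1]`. -/
theorem abs_sub_le_mul_rpow {g : ℝ → ℝ} {B K s : ℝ} (hK : 0 ≤ K)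
    (hb : ∀ x, |g x| ≤ B) (hlip : ∀ x y, |g x - g y| ≤ K * |x - y|) (hs0 : 0 ≤ s) (hs1 : s ≤ 1)
    (x y : ℝ) : |g x - g y| ≤ (2 * B + K) * |x - y| ^ s := by
  have hB : 0 ≤ B := (abs_nonneg _).trans (hb x)
  rcases le_total |x - y| 1 with h | h
  · have h1 : |x - y| ≤ |x - y| ^ s := by
      simpa using Real.rpow_le_rpow_of_exponent_ge' (abs_nonneg (x - y)) h hs0 hs1
    calc |g x - g y| ≤ K * |x - y| := hlip x y
      _ ≤ K * |x - y| ^ s := by gcongr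
      _ ≤ (2 * B + K) * |x - y| ^ s := by gcongr; linarith
  · have h1 : 1 ≤ |x - y| ^ s := Real.one_le_rpow h hs0
    calc |g x - g y| ≤ |g x| + |g y| := abs_sub _ _
      _ ≤ (2 * B + K) * 1 := by linarith [hb x, hb y]
      _ ≤ (2 * B + K) * |x - y| ^ s := by gcongr

/-- Compact support makes the `l`-th derivative bounded and Lipschitz, hence Hölder of order `β - l
∈ [0, 1]`. -/
theorem exists_mem_holderClass {β : ℝ} (hβ : 0 ≤ β) {f : ℝ → ℝ} (hf : ContDiff ℝ ∞ f)
    (hc : HasCompactSupport f) : ∃ A, 0 < A ∧ f ∈ HolderClass β A := by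
  set l := ⌊β⌋₊
  have hg : ContDiff ℝ 1 (iteratedDeriv l f) := by
    rw [iteratedDeriv_eq_iterate]
    exact ContDiff.iterate_deriv' 1 l (hf.of_le (by exact_mod_cast le_top))
  obtain ⟨B, hB⟩ := hg.continuous.bounded_above_of_compact_support
    (hasCompactSupport_iteratedDeriv hc l)
  obtain ⟨K, hK⟩ := hg.lipschitzWith_of_hasCompactSupport
    (hasCompactSupport_iteratedDeriv hc l) one_ne_zero
  refine ⟨2 * |B| + K + 1, by positivity, fun k _ => ?_, fun x y => ?_⟩
  · exact hf.differentiable_iteratedDeriv k (by exact_mod_cast ENat.natCast_lt_top k)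
  · have := abs_sub_le_mul_rpow (g := iteratedDeriv l f) (B := |B|) (K := K) (s := β - l) K.2
      (fun x => (hB x).trans (le_abs_self B))
      (fun x y => by simpa [Real.dist_eq] using hK.dist_le_mul x y)
      (sub_nonneg.2 (Nat.floor_le hβ)) (by linarith [Nat.lt_floor_add_one β]) x y
    refine this.trans ?_
    exact mul_le_mul_of_nonneg_right (by linarith) (by positivity)

theorem add_mem_holderClass {β A B : ℝ} {f g : ℝ → ℝ} (hf : ContDiff ℝ ∞ f)
    (hg : ContDiff ℝ ∞ g) (hfA : f ∈ HolderClass β A) (hgB : g ∈ HolderClass β B) :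
    (fun x => f x + g x) ∈ HolderClass β (A + B) := by
  refine ⟨fun k _ => (hf.add hg).differentiable_iteratedDeriv k
    (by exact_mod_cast ENat.natCast_lt_top k), fun x y => ?_⟩
  have h (x : ℝ) : iteratedDeriv ⌊β⌋₊ (fun x => f x + g x) x =
      iteratedDeriv ⌊β⌋₊ f x + iteratedDeriv ⌊β⌋₊ g x :=
    iteratedDeriv_fun_add (hf.of_le (by exact_mod_cast le_top)).contDiffAt
      (hg.of_le (by exact_mod_cast le_top)).contDiffAt
  rw [h, h, add_mul, add_sub_add_comm]
  exact (abs_add_le _ _).trans (add_le_add (hfA.2 x y) (hgB.2 x y))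

theorem mem_holderClass_mono {β A B : ℝ} (h : A ≤ B) {f : ℝ → ℝ} (hf : f ∈ HolderClass β A) :
    f ∈ HolderClass β B :=
  ⟨hf.1, fun x y => (hf.2 x y).trans (by gcongr)⟩

/-- The `l` derivatives contribute `h⁻¹ ^ l` and the Hölder quotient `h⁻¹ ^ (β - l)`; an amplitude
`c` of order `h ^ β` therefore makes the constant independent of `h`. -/
theorem rescale_mem_holderClass {β A c h : ℝ} (hc : 0 ≤ c) (hh : 0 < h) (t : ℝ) {f : ℝ → ℝ}
    (hf : ContDiff ℝ ∞ f) (hfA : f ∈ HolderClass β A) :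
    (fun x => c * f (h⁻¹ * (x - t))) ∈ HolderClass β (c * h ^ (-β) * A) := by
  have hsm : ContDiff ℝ ∞ (fun x => c * f (h⁻¹ * (x - t))) := by fun_prop
  refine ⟨fun k _ => hsm.differentiable_iteratedDeriv k
    (by exact_mod_cast ENat.natCast_lt_top k), fun x y => ?_⟩
  set l := ⌊β⌋₊
  have hd (x : ℝ) : iteratedDeriv l (fun x => c * f (h⁻¹ * (x - t))) x =
      c * ((h⁻¹) ^ l * iteratedDeriv l f (h⁻¹ * (x - t))) := by
    rw [iteratedDeriv_const_mul_field,
      iteratedDeriv_comp_sub_const (f := fun x => f (h⁻¹ * x)),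
      iteratedDeriv_comp_const_mul (hf.of_le (by exact_mod_cast le_top))]
  have hexp : h⁻¹ ^ l * h⁻¹ ^ (β - l) = h ^ (-β) := by
    rw [← Real.rpow_natCast, ← Real.rpow_add (by positivity), Real.inv_rpow hh.le,
      ← Real.rpow_neg hh.le]
    congr 1
    ring
  have hxy : |h⁻¹ * (x - t) - h⁻¹ * (y - t)| ^ (β - l) = h⁻¹ ^ (β - l) * |x - y| ^ (β - l) := by
    rw [← mul_sub, sub_sub_sub_cancel_right, abs_mul, abs_of_pos (inv_pos.2 hh),
      Real.mul_rpow (by positivity) (abs_nonneg _)]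
  rw [hd, hd, ← mul_sub, ← mul_sub, abs_mul, abs_mul, abs_of_nonneg hc,
    abs_of_nonneg (by positivity : 0 ≤ h⁻¹ ^ l), ← hexp]
  have := hfA.2 (h⁻¹ * (x - t)) (h⁻¹ * (y - t))
  rw [hxy] at this
  calc _ ≤ c * (h⁻¹ ^ l * (A * (h⁻¹ ^ (β - l) * |x - y| ^ (β - l)))) := by gcongr
    _ = _ := by ring

/-! ### Rescaled bumps -/

theorem integrable_rescale {g : ℝ → ℝ} (hg : Integrable g) {h : ℝ} (hh : 0 < h) (t : ℝ) :
    Integrable fun x => g (h⁻¹ * (x - t)) :=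
  (hg.comp_mul_left' (inv_ne_zero hh.ne')).comp_sub_right t

theorem integral_rescale (g : ℝ → ℝ) {h : ℝ} (hh : 0 < h) (t : ℝ) :
    ∫ x, g (h⁻¹ * (x - t)) = h * ∫ x, g x := by
  rw [integral_sub_right_eq_self (fun x => g (h⁻¹ * x)) t, Measure.integral_comp_inv_mul_left]
  simp [abs_of_pos hh]

/-- A smooth compactly supported density that attains its maximum on `[-1, 1]`. -/
theorem exists_flat_bump : ∃ g : ℝ → ℝ, ∃ m > 0, ContDiff ℝ ∞ g ∧ HasCompactSupport g ∧
    IsDensity g ∧ (∀ x, g x ≤ m) ∧ (∀ x, |x| ≤ 1 → g x = m) ∧ ∀ x, 2 ≤ |x| → g x = 0 := by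
  let b : ContDiffBump (0 : ℝ) := ⟨1, 2, one_pos, one_lt_two⟩
  have hI : 0 < ∫ x, b x := b.integral_pos
  refine ⟨b.normed volume, (∫ x, b x)⁻¹, inv_pos.2 hI, b.contDiff_normed,
    b.hasCompactSupport_normed, ⟨b.nonneg_normed, b.integrable_normed, b.integral_normed⟩,
    fun x => ?_, fun x hx => ?_, fun x hx => ?_⟩
  · rw [b.normed_def, div_eq_mul_inv]
    exact mul_le_of_le_one_left (inv_pos.2 hI).le b.le_one
  · rw [b.normed_def, b.one_of_mem_closedBall (by simpa [b] using hx), one_div]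
  · rw [b.normed_def, b.zero_of_le_dist (by simpa [b] using hx), zero_div]

/-- Two Hölder densities whose values at `t` differ by `c h ^ β` and whose `L¹` distance is at
most of order `h ^ (β + 1)`. -/
theorem exists_density_pairs {β L : ℝ} (hβ : 0 < β) (hL : 0 < L) :
    ∃ a > 0, ∃ c > 0, ∃ h₀ > 0, ∀ t h : ℝ, 0 < h → h ≤ h₀ →
      ∃ f₀ ∈ HolderDensities β L, ∃ f₁ ∈ HolderDensities β L,
        f₁ t - f₀ t = c * h ^ β ∧ ∫ x, |f₁ x - f₀ x| ≤ a * h ^ (β + 1) := by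
  obtain ⟨g, m, hm, hgs, hgc, ⟨hg0, hgi, hg1⟩, hgm, hgflat, hgz⟩ := exists_flat_bump
  -- Zero total mass keeps the perturbed function a density. The shift 5 exceeds 4, so the two bumps
  -- do not overlap.
  let ψ : ℝ → ℝ := fun x => g x - g (x - 5)
  have hgs' : ContDiff ℝ ∞ (fun x => g (x - 5)) := by fun_prop
  have hgi' : Integrable (fun x => g (x - 5)) := hgi.comp_sub_right 5
  have hψs : ContDiff ℝ ∞ ψ := hgs.sub hgs'
  have hψc : HasCompactSupport ψ :=
    hgc.sub (hgc.comp_homeomorph (Homeomorph.subRight (5 : ℝ)))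
  have hψi : Integrable ψ := hgi.sub hgi'
  have hψ0 : ∫ x, ψ x = 0 := by
    rw [integral_sub hgi hgi', integral_sub_right_eq_self (fun x => g x) 5, sub_self]
  obtain ⟨A, hA, hgA⟩ := exists_mem_holderClass hβ.le hgs hgc
  obtain ⟨B, hB, hψB⟩ := exists_mem_holderClass hβ.le hψs hψc
  -- A wide enough base density spends only half of the Hölder budget `L`; the choice of `γ` gives
  -- the other half to the perturbation.
  obtain ⟨σ, hσ, hσA⟩ : ∃ σ : ℝ, 0 < σ ∧ σ⁻¹ * σ ^ (-β) * A ≤ L / 2 := by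
    have h1 : Tendsto (fun σ : ℝ => σ⁻¹ * σ ^ (-β) * A) atTop (𝓝 (0 * 0 * A)) :=
      (tendsto_inv_atTop_zero.mul (tendsto_rpow_neg_atTop hβ)).mul_const A
    have h2 : ∀ᶠ σ : ℝ in atTop, σ⁻¹ * σ ^ (-β) * A ≤ L / 2 :=
      (h1.eventually_lt_const (by simpa using hL)).mono fun _ h => h.le
    obtain ⟨σ, h⟩ := ((eventually_gt_atTop 0).and h2).exists
    exact ⟨σ, h⟩
  let γ := L / (2 * B)
  have hγ : 0 < γ := by positivity
  obtain ⟨h₁, hh₁, hh₁σ⟩ : ∃ h₁ : ℝ, 0 < h₁ ∧ γ * h₁ ^ β ≤ σ⁻¹ := by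
    refine ⟨(σ⁻¹ / γ) ^ β⁻¹, by positivity, ?_⟩
    rw [Real.rpow_inv_rpow (by positivity) hβ.ne', mul_div_cancel₀ _ hγ.ne']
  -- `h₁` keeps the perturbation below the plateau height of `f₀`; `σ / 7` keeps its support, within
  -- `7 h` of `t`, inside the plateau.
  refine ⟨γ * ((∫ x, |ψ x|) + 1), ?_, γ * m, by positivity, min h₁ (σ / 7), by positivity, ?_⟩
  · have : 0 ≤ ∫ x, |ψ x| := integral_nonneg fun x => abs_nonneg _
    positivity
  intro t h hh hle
  have hγh : γ * h ^ β ≤ σ⁻¹ := by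
    refine le_trans ?_ hh₁σ
    gcongr
    exact hle.trans (min_le_left _ _)
  have h7 : 7 * h ≤ σ := by linarith [hle.trans (min_le_right _ _)]
  let f₀ : ℝ → ℝ := fun x => σ⁻¹ * g (σ⁻¹ * (x - t))
  let p : ℝ → ℝ := fun x => γ * h ^ β * ψ (h⁻¹ * (x - t))
  have hf₀s : ContDiff ℝ ∞ f₀ := by fun_prop
  have hps : ContDiff ℝ ∞ p := by fun_prop
  have hf₀i : Integrable f₀ := (integrable_rescale hgi hσ t).const_mul _
  have hpi : Integrable p := (integrable_rescale hψi hh t).const_mul _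
  have hf₀H : f₀ ∈ HolderClass β (L / 2) :=
    mem_holderClass_mono hσA (rescale_mem_holderClass (inv_pos.2 hσ).le hσ t hgs hgA)
  have hpH : p ∈ HolderClass β (L / 2) := by
    refine mem_holderClass_mono (le_of_eq ?_)
      (rescale_mem_holderClass (by positivity : 0 ≤ γ * h ^ β) hh t hψs hψB)
    rw [mul_assoc γ, ← Real.rpow_add hh, add_neg_cancel, Real.rpow_zero]
    simp only [γ]
    field_simp
  have hf₀0 (x : ℝ) : 0 ≤ f₀ x := mul_nonneg (inv_pos.2 hσ).le (hg0 _)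
  have hf₀1 : ∫ x, f₀ x = 1 := by
    rw [integral_const_mul, integral_rescale g hσ, hg1]
    field_simp
  have hp0 : ∫ x, p x = 0 := by
    rw [integral_const_mul, integral_rescale ψ hh, hψ0]
    ring
  refine ⟨f₀, ⟨⟨hf₀0, hf₀i, hf₀1⟩, mem_holderClass_mono (by linarith) hf₀H⟩,
    fun x => f₀ x + p x, ⟨⟨fun x => ?_, hf₀i.add hpi, ?_⟩, ?_⟩, ?_, ?_⟩
  · rcases le_total |x - t| σ with hx | hx
    · have e : f₀ x = σ⁻¹ * m := by
        simp only [f₀]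
        rw [hgflat]
        rw [abs_mul, abs_of_pos (inv_pos.2 hσ), inv_mul_le_iff₀ hσ]
        linarith
      have e' : γ * h ^ β * -m ≤ p x := by
        refine mul_le_mul_of_nonneg_left ?_ (by positivity)
        simp only [ψ]
        linarith [hg0 (h⁻¹ * (x - t)), hgm (h⁻¹ * (x - t) - 5)]
      nlinarith
    -- Off the plateau `|x - t| ≥ σ ≥ 7 h`, so the negative bump vanishes because `7 - 5 = 2`.
    · refine add_nonneg (hf₀0 x) (mul_nonneg (by positivity) ?_)
      simp only [ψ]
      rw [hgz (h⁻¹ * (x - t) - 5), sub_zero]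
      · exact hg0 _
      · have h1 : 7 ≤ |h⁻¹ * (x - t)| := by
          rw [abs_mul, abs_of_pos (inv_pos.2 hh), le_inv_mul_iff₀ hh]
          linarith
        have h2 := abs_sub_abs_le_abs_sub (h⁻¹ * (x - t)) 5
        rw [abs_of_pos (by norm_num : (0 : ℝ) < 5)] at h2
        linarith
  · rw [integral_add hf₀i hpi, hf₀1, hp0, add_zero]
  · simpa using add_mem_holderClass hf₀s hps hf₀H hpH
  · have h0 : ψ 0 = m := by
      simp only [ψ]
      rw [hgflat 0 (by simp), hgz (0 - 5) (by norm_num [abs_of_pos]), sub_zero]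
    simp only [p, sub_self, mul_zero, h0]
    ring
  · have e (x : ℝ) : |f₀ x + p x - f₀ x| = γ * h ^ β * |ψ (h⁻¹ * (x - t))| := by
      rw [add_sub_cancel_left, abs_mul, abs_of_nonneg (by positivity)]
    simp only [e]
    rw [integral_const_mul, integral_rescale (fun x => |ψ x|) hh, Real.rpow_add_one hh.ne']
    have : 0 ≤ γ * (h ^ β * h) := by positivity
    nlinarith

/-! ### Chi-square bounds in dual form -/

/-- `ν` has a density with respect to `μ` whose second moment is at most `K`, expressed through
nonnegative test functions. -/
def SecondMomentBound {Z : Type*} [MeasurableSpace Z] (K : ℝ≥0∞) (ν μ : Measure Z) : Prop :=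
  ∀ g : Z → ℝ≥0∞, Measurable g → (∫⁻ z, g z ∂ν) ^ 2 ≤ K * ∫⁻ z, g z ^ 2 ∂μ

theorem sq_lintegral_mul_le {Z : Type*} [MeasurableSpace Z] (μ : Measure Z) {f g : Z → ℝ≥0∞}
    (hf : AEMeasurable f μ) (hg : AEMeasurable g μ) :
    (∫⁻ z, f z * g z ∂μ) ^ 2 ≤ (∫⁻ z, f z ^ 2 ∂μ) * ∫⁻ z, g z ^ 2 ∂μ := by
  have h := ENNReal.lintegral_mul_le_Lp_mul_Lq μ Real.HolderConjugate.two_two hf hg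
  have hsq (x : ℝ≥0∞) : (x ^ (1 / 2 : ℝ)) ^ 2 = x := by
    rw [← ENNReal.rpow_natCast, ← ENNReal.rpow_mul]
    norm_num
  calc _ ≤ _ := pow_le_pow_left' h 2
    _ = _ := by rw [mul_pow, hsq, hsq]; simp

theorem secondMomentBound_self {Z : Type*} [MeasurableSpace Z] (μ : Measure Z)
    [IsProbabilityMeasure μ] : SecondMomentBound 1 μ μ := fun g hg => by
  simpa using sq_lintegral_mul_le μ (f := fun _ => 1) aemeasurable_const hg.aemeasurable

/-- A setwise relative error `δ` gives the second moment bound `1 + δ²`. -/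
theorem secondMomentBound_of_relative_error {Z : Type*} [MeasurableSpace Z] {ν μ : Measure Z}
    [IsProbabilityMeasure ν] [IsProbabilityMeasure μ] {δ : ℝ} (hδ : 0 ≤ δ)
    (h : ∀ B, MeasurableSet B → |ν.real B - μ.real B| ≤ δ * μ.real B) :
    SecondMomentBound (ENNReal.ofReal (1 + δ ^ 2)) ν μ := by
  have hac : ν ≪ μ := Measure.AbsolutelyContinuous.mk fun s hs h0 => by
    have := h s hs
    have h0' : μ.real s = 0 := by simp [measureReal_def, h0]
    rw [h0', mul_zero, sub_zero, abs_nonpos_iff] at this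
    exact (measureReal_eq_zero_iff).1 this
  set r := ν.rnDeriv μ
  have hr : Measurable r := Measure.measurable_rnDeriv ν μ
  have hrint (s : Set Z) (hs : MeasurableSet s) : ∫⁻ z in s, r z ∂μ = ν s :=
    Measure.setLIntegral_rnDeriv' hac hs
  have hup : r ≤ᵐ[μ] fun _ => ENNReal.ofReal (1 + δ) := by
    refine ae_le_of_forall_setLIntegral_le_of_sigmaFinite hr fun s hs _ => ?_
    rw [hrint s hs, setLIntegral_const, ← ofReal_measureReal, ← ofReal_measureReal,
      ← ENNReal.ofReal_mul (by positivity)]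
    exact ENNReal.ofReal_le_ofReal (by linarith [(abs_le.1 (h s hs)).2])
  have hlow : (fun _ => (1 : ℝ≥0∞)) ≤ᵐ[μ] fun z => r z + ENNReal.ofReal δ := by
    refine ae_le_of_forall_setLIntegral_le_of_sigmaFinite measurable_const fun s hs _ => ?_
    rw [lintegral_add_left hr, hrint s hs, setLIntegral_const, setLIntegral_const, one_mul,
      ← ofReal_measureReal, ← ofReal_measureReal,
      ← ENNReal.ofReal_mul (by positivity), ← ENNReal.ofReal_add (by positivity) (by positivity)]
    exact ENNReal.ofReal_le_ofReal (by linarith [(abs_le.1 (h s hs)).1])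
  -- This is `(r - 1)² ≤ δ²`, rearranged to avoid subtraction in `ℝ≥0∞`; integrating with `∫ r = 1`
  -- gives the bound.
  have hpt : ∀ᵐ z ∂μ, r z ^ 2 + 1 ≤ 2 * r z + ENNReal.ofReal (δ ^ 2) := by
    filter_upwards [hup, hlow] with z h1 h2
    have hfin : r z ≠ ⊤ := (h1.trans_lt ENNReal.ofReal_lt_top).ne
    lift r z to NNReal using hfin with x
    have h1' : (x : ℝ) ≤ 1 + δ := by
      have := ENNReal.toReal_le_of_le_ofReal (by positivity) h1
      simpa using this
    have h2' : 1 ≤ (x : ℝ) + δ := by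
      have := ENNReal.toReal_mono (by simp) h2
      rw [ENNReal.toReal_add (by simp) (by simp)] at this
      simpa [hδ] using this
    rw [← ENNReal.ofReal_coe_nnreal]
    have e1 : ENNReal.ofReal x ^ 2 + 1 = ENNReal.ofReal ((x : ℝ) ^ 2 + 1) := by
      rw [ENNReal.ofReal_add (by positivity) (by positivity), ENNReal.ofReal_pow x.coe_nonneg]; simp
    have e2 : 2 * ENNReal.ofReal x + ENNReal.ofReal (δ ^ 2) =
        ENNReal.ofReal (2 * (x : ℝ) + δ ^ 2) := by
      rw [ENNReal.ofReal_add (by positivity) (by positivity), ENNReal.ofReal_mul (by norm_num)]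
      simp
    rw [e1, e2]
    exact ENNReal.ofReal_le_ofReal (by nlinarith)
  have hsq : ∫⁻ z, r z ^ 2 ∂μ ≤ ENNReal.ofReal (1 + δ ^ 2) := by
    have := lintegral_mono_ae hpt
    rw [lintegral_add_right _ measurable_const, lintegral_add_right _ measurable_const,
      lintegral_const_mul _ hr, Measure.lintegral_rnDeriv hac] at this
    simp only [lintegral_const, measure_univ, mul_one] at this
    rw [ENNReal.ofReal_add zero_le_one (by positivity), ENNReal.ofReal_one]
    rw [← one_add_one_eq_two (R := ℝ≥0∞), add_comm, add_assoc] at this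
    exact (ENNReal.add_le_add_iff_left ENNReal.one_ne_top).1 this
  intro g hg
  calc (∫⁻ z, g z ∂ν) ^ 2 = (∫⁻ z, r z * g z ∂μ) ^ 2 := by
        rw [lintegral_rnDeriv_mul hac hg.aemeasurable]
    _ ≤ (∫⁻ z, r z ^ 2 ∂μ) * ∫⁻ z, g z ^ 2 ∂μ :=
        sq_lintegral_mul_le μ hr.aemeasurable hg.aemeasurable
    _ ≤ _ := by gcongr

/-- In dual form, tensorization is Fubini: one bound is applied to the partial integral, the other
on each fibre, and no product density is needed. -/
theorem SecondMomentBound.prod {X Y : Type*} [MeasurableSpace X] [MeasurableSpace Y]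
    {K K' : ℝ≥0∞} {ν μ : Measure X} {ν' μ' : Measure Y} [SFinite μ] [SFinite ν] [SFinite ν']
    [SFinite μ'] (h : SecondMomentBound K ν μ) (h' : SecondMomentBound K' ν' μ') :
    SecondMomentBound (K * K') (ν.prod ν') (μ.prod μ') := by
  intro g hg
  have hsq (x : ℝ≥0∞) : (x ^ (1 / 2 : ℝ)) ^ 2 = x := by
    rw [← ENNReal.rpow_natCast, ← ENNReal.rpow_mul]
    norm_num
  let G : X → ℝ≥0∞ := fun x => ∫⁻ y, g (x, y) ∂ν'
  have hG : Measurable G := hg.lintegral_prod_right'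
  rw [lintegral_prod _ hg.aemeasurable, lintegral_prod _ (hg.pow_const 2).aemeasurable]
  calc (∫⁻ x, G x ∂ν) ^ 2 ≤ K * ∫⁻ x, G x ^ 2 ∂μ := h G hG
    _ ≤ K * ∫⁻ x, K' * ∫⁻ y, g (x, y) ^ 2 ∂μ' ∂μ := by
        gcongr with x
        exact h' _ (hg.comp measurable_prodMk_left)
    _ = _ := by
        rw [lintegral_const_mul _ (hg.pow_const 2).lintegral_prod_right', mul_assoc]

theorem SecondMomentBound.of_measurePreserving {X Y : Type*} [MeasurableSpace X]
    [MeasurableSpace Y] {K : ℝ≥0∞} {ν μ : Measure X} {ν' μ' : Measure Y} (e : X ≃ᵐ Y)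
    (hν : MeasurePreserving e ν ν') (hμ : MeasurePreserving e μ μ')
    (h : SecondMomentBound K ν' μ') : SecondMomentBound K ν μ := by
  intro g hg
  have := h (fun y => g (e.symm y)) (hg.comp e.symm.measurable)
  rw [← hν.lintegral_comp_emb e.measurableEmbedding,
    ← hμ.lintegral_comp_emb e.measurableEmbedding] at this
  simpa using this

theorem SecondMomentBound.pi {n : ℕ} {Z : Fin n → Type*} [∀ i, MeasurableSpace (Z i)]
    {K : ℝ≥0∞} {ν μ : ∀ i, Measure (Z i)} [∀ i, IsProbabilityMeasure (ν i)]
    [∀ i, IsProbabilityMeasure (μ i)] (h : ∀ i, SecondMomentBound K (ν i) (μ i)) :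
    SecondMomentBound (K ^ n) (Measure.pi ν) (Measure.pi μ) := by
  induction n with
  | zero =>
    rw [Measure.pi_of_empty ν, Measure.pi_of_empty μ, pow_zero]
    exact secondMomentBound_self _
  | succ n ih =>
    have hp := (h 0).prod (ih (fun j : Fin n => h (Fin.succAbove 0 j)))
    rw [← pow_succ'] at hp
    exact hp.of_measurePreserving (MeasurableEquiv.piFinSuccAbove Z 0)
      (measurePreserving_piFinSuccAbove ν 0) (measurePreserving_piFinSuccAbove μ 0)

/-! ### Le Cam's two-point method -/

/-- The error around `a` is transferred from `μ` to `ν` at the cost of `K`; the triangle inequality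
under `ν` then bounds `|b - a|` by two terms whose squares are at most `K * S`, whence the factor 4.
-/
theorem sq_le_of_two_point {Z : Type*} [MeasurableSpace Z] {ν μ : Measure Z}
    [IsProbabilityMeasure ν] {K S : ℝ≥0∞} (hK : 1 ≤ K) (h : SecondMomentBound K ν μ)
    {T : Z → ℝ} (hT : Measurable T) (κ a b : ℝ)
    (ha : ∫⁻ z, ENNReal.ofReal (κ * |T z - a| ^ 2) ∂μ ≤ S)
    (hb : ∫⁻ z, ENNReal.ofReal (κ * |T z - b| ^ 2) ∂ν ≤ S) :
    ENNReal.ofReal (κ * |b - a| ^ 2) ≤ 4 * K * S := by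
  rcases le_total κ 0 with hκ | hκ
  · rw [ENNReal.ofReal_of_nonpos (mul_nonpos_of_nonpos_of_nonneg hκ (by positivity))]
    exact zero_le
  have hsq (x : ℝ) : ENNReal.ofReal (κ * |x| ^ 2) = ENNReal.ofReal (√κ * |x|) ^ 2 := by
    rw [← ENNReal.ofReal_pow (by positivity), mul_pow, Real.sq_sqrt hκ]
  simp only [hsq] at ha hb ⊢
  set u : Z → ℝ≥0∞ := fun z => ENNReal.ofReal (√κ * |T z - a|)
  set v : Z → ℝ≥0∞ := fun z => ENNReal.ofReal (√κ * |T z - b|)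
  have hu : Measurable u := by fun_prop
  have hv : Measurable v := by fun_prop
  have hu2 : (∫⁻ z, u z ∂ν) ^ 2 ≤ K * S := (h u hu).trans (by gcongr)
  have hv2 : (∫⁻ z, v z ∂ν) ^ 2 ≤ K * S :=
    (secondMomentBound_self ν v hv).trans (by gcongr)
  have htri : ENNReal.ofReal (√κ * |b - a|) ≤ ∫⁻ z, u z ∂ν + ∫⁻ z, v z ∂ν := by
    rw [← lintegral_add_left hu]
    calc ENNReal.ofReal (√κ * |b - a|) = ∫⁻ _, ENNReal.ofReal (√κ * |b - a|) ∂ν := by simp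
      _ ≤ _ := lintegral_mono fun z => by
        rw [← ENNReal.ofReal_add (by positivity) (by positivity), ← mul_add]
        gcongr
        rw [add_comm, abs_sub_comm (T z) b]
        exact abs_sub_le b (T z) a
  calc _ ≤ (∫⁻ z, u z ∂ν + ∫⁻ z, v z ∂ν) ^ 2 := pow_le_pow_left' htri 2
    _ ≤ (2 * max (∫⁻ z, u z ∂ν) (∫⁻ z, v z ∂ν)) ^ 2 := by
      gcongr
      rw [two_mul]
      exact add_le_add (le_max_left _ _) (le_max_right _ _)
    _ = 4 * (max (∫⁻ z, u z ∂ν) (∫⁻ z, v z ∂ν)) ^ 2 := by rw [mul_pow]; norm_num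
    _ ≤ 4 * (K * S) := by
      gcongr
      rcases max_choice (∫⁻ z, u z ∂ν) (∫⁻ z, v z ∂ν) with hmax | hmax <;> rw [hmax] <;>
        assumption
    _ = _ := by ring

/-! ### Contraction of private channels -/

theorem isProbabilityMeasure_rawLaw {f : ℝ → ℝ} (hf : IsDensity f) :
    IsProbabilityMeasure (rawLaw f) := by
  refine ⟨?_⟩
  rw [rawLaw, withDensity_apply _ MeasurableSet.univ, Measure.restrict_univ,
    ← ofReal_integral_eq_lintegral_ofReal hf.2.1 (ae_of_all _ hf.1), hf.2.2, ENNReal.ofReal_one]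

theorem measureReal_bind_rawLaw {Z : Type*} [MeasurableSpace Z] (Q : Kernel ℝ Z)
    [IsMarkovKernel Q] {f : ℝ → ℝ} (hf : IsDensity f) {B : Set Z} (hB : MeasurableSet B) :
    ((rawLaw f).bind Q).real B = ∫ x, (Q x).real B * f x := by
  have hQ : Measurable fun x => Q x B := Q.measurable_coe hB
  rw [measureReal_def, Measure.bind_apply hB Q.aemeasurable, rawLaw,
    lintegral_withDensity_eq_lintegral_mul₀ hf.2.1.aestronglyMeasurable.aemeasurable.ennreal_ofReal
      hQ.aemeasurable,
    integral_eq_lintegral_of_nonneg_ae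
      (ae_of_all _ fun x => mul_nonneg measureReal_nonneg (hf.1 x))
      (hQ.ennreal_toReal.aestronglyMeasurable.mul hf.2.1.aestronglyMeasurable)]
  congr 1
  refine lintegral_congr fun x => ?_
  rw [ENNReal.ofReal_mul measureReal_nonneg, ofReal_measureReal, Pi.mul_apply, mul_comm]

/-- A locally private channel turns an `L¹` distance of densities into a relative error of the
distributions of the private view. -/
theorem abs_sub_bind_le {Z : Type u} [MeasurableSpace Z] {α : ℝ} (hα : 0 ≤ α)
    {Q : Kernel ℝ Z} [IsMarkovKernel Q] (hQ : IsLocallyPrivate α Q) {f₀ f₁ : ℝ → ℝ}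
    (h₀ : IsDensity f₀) (h₁ : IsDensity f₁) {B : Set Z} (hB : MeasurableSet B) :
    |((rawLaw f₁).bind Q).real B - ((rawLaw f₀).bind Q).real B| ≤
      ((Real.exp α - 1) * ∫ x, |f₁ x - f₀ x|) * ((rawLaw f₀).bind Q).real B := by
  rw [measureReal_bind_rawLaw Q h₁ hB, measureReal_bind_rawLaw Q h₀ hB]
  set q : ℝ → ℝ := fun x => (Q x).real B
  have hqm : Measurable q := (Q.measurable_coe hB).ennreal_toReal
  have hq0 (x : ℝ) : 0 ≤ q x := measureReal_nonneg
  have hq1 (x : ℝ) : q x ≤ 1 := measureReal_le_one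
  have hqq (x x' : ℝ) : q x ≤ Real.exp α * q x' := by
    have := ENNReal.toReal_mono (by finiteness) (hQ B hB x x')
    rwa [ENNReal.toReal_mul, ENNReal.toReal_ofReal (by positivity)] at this
  have hqi {f : ℝ → ℝ} (hf : Integrable f) : Integrable fun x => q x * f x :=
    hf.bdd_mul hqm.aestronglyMeasurable
      (ae_of_all _ fun x => by rw [Real.norm_of_nonneg (hq0 x)]; exact hq1 x)
  set M := ∫ x, q x * f₀ x
  -- Averaging the privacy inequality over `f₀` compares each `q x` with the mean `M`, in both
  -- directions.
  have hle (x : ℝ) : q x ≤ Real.exp α * M := by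
    calc q x = ∫ y, q x * f₀ y := by rw [integral_const_mul, h₀.2.2, mul_one]
      _ ≤ ∫ y, Real.exp α * (q y * f₀ y) := by
        refine integral_mono (h₀.2.1.const_mul _) ((hqi h₀.2.1).const_mul _) fun y => ?_
        have := mul_le_mul_of_nonneg_right (hqq x y) (h₀.1 y)
        simpa [mul_assoc] using this
      _ = _ := integral_const_mul _ _
  have hge (x : ℝ) : M ≤ Real.exp α * q x := by
    calc M ≤ ∫ y, Real.exp α * q x * f₀ y :=
          integral_mono (hqi h₀.2.1) (h₀.2.1.const_mul _) fun y =>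
            mul_le_mul_of_nonneg_right (hqq y x) (h₀.1 y)
      _ = _ := by rw [integral_const_mul, h₀.2.2, mul_one]
  have hM : 0 ≤ M := integral_nonneg fun x => mul_nonneg (hq0 x) (h₀.1 x)
  have hexp : 1 ≤ Real.exp α := Real.one_le_exp hα
  have hdev (x : ℝ) : |q x - M| ≤ (Real.exp α - 1) * M := by
    rw [abs_le]
    refine ⟨?_, by linarith [hle x]⟩
    rcases le_total M (q x) with h | h
    · nlinarith
    · nlinarith [hge x]
  have hd : Integrable fun x => f₁ x - f₀ x := h₁.2.1.sub h₀.2.1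
  -- Centring at `M` is free because `f₁ - f₀` has integral zero; it is what makes the error
  -- relative to `M`.
  have hkey : (∫ x, q x * f₁ x) - M = ∫ x, (q x - M) * (f₁ x - f₀ x) := by
    have h0 : ∫ x, (f₁ x - f₀ x) = 0 := by
      rw [integral_sub h₁.2.1 h₀.2.1, h₁.2.2, h₀.2.2, sub_self]
    simp only [sub_mul]
    rw [integral_sub (hqi hd) (hd.const_mul M), integral_const_mul, h0, mul_zero, sub_zero]
    simp only [mul_sub]
    rw [integral_sub (hqi h₁.2.1) (hqi h₀.2.1)]
  rw [hkey]
  calc |∫ x, (q x - M) * (f₁ x - f₀ x)| ≤ ∫ x, |(q x - M) * (f₁ x - f₀ x)| :=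
        abs_integral_le_integral_abs
    _ ≤ ∫ x, (Real.exp α - 1) * M * |f₁ x - f₀ x| := by
        refine integral_mono_of_nonneg (ae_of_all _ fun x => abs_nonneg _)
          (hd.abs.const_mul _) (ae_of_all _ fun x => ?_)
        simp only [abs_mul]
        gcongr
        exact hdev x
    _ = _ := by rw [integral_const_mul]; ring

theorem secondMomentBound_viewLaw {α : ℝ} (hα : 0 ≤ α) {n : ℕ}
    (Q : PrivacyMechanism.{u} α n) {f₀ f₁ : ℝ → ℝ} (h₀ : IsDensity f₀) (h₁ : IsDensity f₁) :
    SecondMomentBound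
      (ENNReal.ofReal (Real.exp (n * ((Real.exp α - 1) * ∫ x, |f₁ x - f₀ x|) ^ 2)))
      (Q.viewLaw f₁) (Q.viewLaw f₀) := by
  set δ := (Real.exp α - 1) * ∫ x, |f₁ x - f₀ x|
  have hδ : 0 ≤ δ := mul_nonneg (sub_nonneg.2 (Real.one_le_exp hα))
    (integral_nonneg fun x => abs_nonneg _)
  have := isProbabilityMeasure_rawLaw h₀
  have := isProbabilityMeasure_rawLaw h₁
  have hpi := SecondMomentBound.pi fun i =>
    secondMomentBound_of_relative_error hδ fun B hB =>
      abs_sub_bind_le hα (Q.isPrivate i) h₀ h₁ hB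
  intro g hg
  refine (hpi g hg).trans (mul_le_mul_left ?_ _)
  rw [← ENNReal.ofReal_pow (by positivity), Real.exp_nat_mul]
  gcongr
  rw [add_comm]
  exact Real.add_one_le_exp _

theorem le_normalizedMinimaxRisk {β L α t : ℝ} (hα : 0 ≤ α) (n : ℕ) {f₀ f₁ : ℝ → ℝ}
    (h₀ : f₀ ∈ HolderDensities β L) (h₁ : f₁ ∈ HolderDensities β L) {v D : ℝ}
    (hv : n * ((Real.exp α - 1) * ∫ x, |f₁ x - f₀ x|) ^ 2 ≤ v) (hv0 : 0 ≤ v)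
    (hD : D ≤ ((n : ℝ) * (Real.exp α - 1) ^ 2) ^ (2 * β / (2 * β + 2)) * |f₁ t - f₀ t| ^ 2) :
    ENNReal.ofReal (D / (4 * Real.exp v)) ≤ normalizedMinimaxRisk.{u} β L α t n := by
  refine le_iInf fun Q => le_iInf fun T => le_iInf fun hT => ?_
  set S := ⨆ f ∈ HolderDensities β L, ∫⁻ z, ENNReal.ofReal
    (((n : ℝ) * (Real.exp α - 1) ^ 2) ^ (2 * β / (2 * β + 2)) * |T z - f t| ^ 2) ∂(Q.viewLaw f)
  have hS {f : ℝ → ℝ} (hf : f ∈ HolderDensities β L) : ∫⁻ z, ENNReal.ofReal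
      (((n : ℝ) * (Real.exp α - 1) ^ 2) ^ (2 * β / (2 * β + 2)) * |T z - f t| ^ 2)
        ∂(Q.viewLaw f) ≤ S :=
    le_iSup₂_of_le f hf le_rfl
  have : IsProbabilityMeasure (Q.viewLaw f₁) := by
    have := isProbabilityMeasure_rawLaw h₁.1
    unfold PrivacyMechanism.viewLaw
    infer_instance
  have hK : SecondMomentBound (ENNReal.ofReal (Real.exp v)) (Q.viewLaw f₁) (Q.viewLaw f₀) :=
    fun g hg => (secondMomentBound_viewLaw hα Q h₀.1 h₁.1 g hg).trans
      (mul_le_mul_left (ENNReal.ofReal_le_ofReal (Real.exp_le_exp.2 hv)) _)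
  have h1 : 1 ≤ ENNReal.ofReal (Real.exp v) :=
    ENNReal.one_le_ofReal.2 (Real.one_le_exp hv0)
  have key := (ENNReal.ofReal_le_ofReal hD).trans
    (sq_le_of_two_point h1 hK hT _ (f₀ t) (f₁ t) (hS h₀) (hS h₁))
  rw [ENNReal.ofReal_div_of_pos (by positivity), ENNReal.ofReal_mul (by norm_num)]
  refine ENNReal.div_le_of_le_mul ?_
  rw [mul_comm]
  simpa using key

end PrivateDensity

theorem mainTheorem1 (β L : ℝ) (hβ : 0 < β) (hL : 0 < L) :
    ∃ C : ℝ, 0 < C ∧ ∀ α : ℝ, 0 < α → ∀ t : ℝ,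
      ENNReal.ofReal C ≤
        liminf (fun n : ℕ => PrivateDensity.normalizedMinimaxRisk.{u} β L α t n) atTop := by
  obtain ⟨a, ha, c, hc, h₀, hh₀, hpair⟩ := PrivateDensity.exists_density_pairs hβ hL
  refine ⟨c ^ 2 / (4 * Real.exp (a ^ 2)), by positivity, fun α hα t => ?_⟩
  have hE : 0 < Real.exp α - 1 := sub_pos.2 (Real.one_lt_exp_iff.2 hα)
  set N : ℕ → ℝ := fun n => (n : ℝ) * (Real.exp α - 1) ^ 2
  -- The bandwidth solves `N * h ^ (2β + 2) = 1`, so the divergence exponent is at most `a ^ 2` and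
  -- the normalized squared separation is exactly `c ^ 2`.
  set h : ℕ → ℝ := fun n => N n ^ (-(1 / (2 * β + 2)))
  have hNtop : Tendsto N atTop atTop :=
    tendsto_natCast_atTop_atTop.atTop_mul_const (by positivity)
  have hh : Tendsto h atTop (𝓝 0) := (tendsto_rpow_neg_atTop (by positivity)).comp hNtop
  refine le_liminf_of_le (by isBoundedDefault) ?_
  filter_upwards [hh.eventually_le_const hh₀, eventually_gt_atTop 0] with n hn hn0
  have hN : 0 < N n := by positivity
  have hpos : 0 < h n := Real.rpow_pos_of_pos hN _
  obtain ⟨f₀, hf₀, f₁, hf₁, hval, hdist⟩ := hpair t (h n) hpos hn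
  refine PrivateDensity.le_normalizedMinimaxRisk hα.le n hf₀ hf₁ ?_ (by positivity) ?_
  · have hpow : N n * (h n ^ (β + 1)) ^ 2 = 1 := by
      rw [← Real.rpow_natCast, ← Real.rpow_mul hpos.le, ← Real.rpow_mul hN.le]
      nth_rw 1 [← Real.rpow_one (N n)]
      rw [← Real.rpow_add hN]
      convert Real.rpow_zero (N n) using 2
      push_cast
      field_simp
      ring
    calc n * ((Real.exp α - 1) * ∫ x, |f₁ x - f₀ x|) ^ 2
        = N n * (∫ x, |f₁ x - f₀ x|) ^ 2 := by simp only [N]; ring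
      _ ≤ N n * (a * h n ^ (β + 1)) ^ 2 := by
        gcongr
      _ = a ^ 2 * (N n * (h n ^ (β + 1)) ^ 2) := by ring
      _ = a ^ 2 := by rw [hpow, mul_one]
  · have hpow : N n ^ (2 * β / (2 * β + 2)) * (h n ^ β) ^ 2 = 1 := by
      rw [← Real.rpow_natCast, ← Real.rpow_mul hpos.le, ← Real.rpow_mul hN.le,
        ← Real.rpow_add hN]
      convert Real.rpow_zero (N n) using 2
      push_cast
      field_simp
      ring
    rw [hval, sq_abs, mul_pow]
    exact le_of_eq (by linear_combination -(c ^ 2) * hpow)
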